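/- Let $A\in\mathbb{R}^{m\times n_x}$, $B\in\mathbb{R}^{m\times n_y}$, $b\in\mathbb{R}^m$, and suppose that the polyhedron $D=\{(x,y)\in\mathbb{R}^{n_x}\times\mathbb{R}^{n_y} : Ax+By\le b\}$ is compact and full-dimensional (its affine hull has dimension $n_x+n_y$). Let $\pi(x,y)=x$ and $X=\pi(D)$. A face of $D$ is the set of maximizers over $D$ of some linear function (so $D$ itself is a face); let $\mathscr{F}(D)$ be the set of all faces of $D$ and $\mathscr{F}_{\le k}(D)$ the set of those faces whose affine hull has dimension at most $k$. For $x\in X$, the chamber of $x$ is \[\sigma(x)=\bigcap\{\pi(F) : F\in\mathscr{F}(D),\ x\in\pi(F)\},\] and the chamber complex is $\mathscr{C}(D)=\{\sigma(x) : x\in X\}$. Write $\operatorname{ri}(C)$ for the relative interior of $C$, i.e. its interior relative to its affine hull. Then, for every $x\in X$: \begin{enumerate} \item $\sigma(x)=\bigcap\{\pi(F) : F\in\mathscr{F}_{\le n_x}(D),\ x\in\pi(F)\}$. \item For every $C\in\mathscr{C}(D)$, one has $x\in\operatorname{ri}(C)$ if and only if $C=\sigma(x)$. \end{enumerate} -/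

import Mathlib

open scoped Matrix

namespace Chamber

/-- A face of `P` is the argmax over `P` of some linear function. The zero function gives `P`. -/
def IsFace {E : Type*} [AddCommGroup E] [Module ℝ E] (P F : Set E) : Prop :=
  ∃ l : E →ₗ[ℝ] ℝ, F = {p | p ∈ P ∧ ∀ q ∈ P, l q ≤ l p}

/-- The collection `ℱ(P)` of all faces of `P`. -/
def faces {E : Type*} [AddCommGroup E] [Module ℝ E] (P : Set E) : Set (Set E) :=
  {F | IsFace P F}

/-- The affine dimension of a (nonempty) set: the dimension of its affine hull. -/
noncomputable def adim {E : Type*} [AddCommGroup E] [Module ℝ E] (S : Set E) : ℕ :=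
  Module.finrank ℝ (affineSpan ℝ S).direction

/-- The collection `ℱ_{≤ k}(P)` of all faces of `P` of affine dimension at most `k`. -/
def facesLE {E : Type*} [AddCommGroup E] [Module ℝ E] (P : Set E) (k : ℕ) : Set (Set E) :=
  {F | F ∈ faces P ∧ adim F ≤ k}

/-- The polyhedron `D = {(x, y) : A x + B y ≤ b}`, the inequality being coordinatewise. -/
def polyhedron {m nx ny : ℕ} (A : Matrix (Fin m) (Fin nx) ℝ) (B : Matrix (Fin m) (Fin ny) ℝ)
    (b : Fin m → ℝ) : Set ((Fin nx → ℝ) × (Fin ny → ℝ)) :=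
  {p | A *ᵥ p.1 + B *ᵥ p.2 ≤ b}

/-- The image of a subset of `ℝ^nx × ℝ^ny` under the projection `π (x, y) = x`. -/
def proj {nx ny : ℕ} (S : Set ((Fin nx → ℝ) × (Fin ny → ℝ))) : Set (Fin nx → ℝ) :=
  Prod.fst '' S

/-- The chamber `σ(x)`: the intersection of the projections of all faces of `D` whose projection
contains `x`. -/
def chamber {nx ny : ℕ} (D : Set ((Fin nx → ℝ) × (Fin ny → ℝ))) (x : Fin nx → ℝ) :
    Set (Fin nx → ℝ) :=
  ⋂₀ {Q | ∃ F ∈ faces D, x ∈ proj F ∧ Q = proj F}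

/-- The chamber complex `𝒞(D) = {σ(x) : x ∈ π(D)}`. -/
def chamberComplex {nx ny : ℕ} (D : Set ((Fin nx → ℝ) × (Fin ny → ℝ))) :
    Set (Set (Fin nx → ℝ)) :=
  {C | ∃ x ∈ proj D, C = chamber D x}

end Chamber

namespace Chamber

/-! The face cut out by the constraints tight at a point `p` is the smallest face containing `p`
(`tightFace_subset_of_isFace`), so σ(x) is the intersection of the projections of these minimal
faces over the fiber of x. For the first claim, an extreme point of the compact fiber of a face F
over x has a minimal face inside F with no vertical direction, hence of dimension at most nx. For
the second, finitely many minimal faces occur over x, so every segment of σ(x) ending at x can be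
prolonged in all of them at once, and x ∈ ri σ(x). Conversely, x ∈ ri σ(x') gives σ(x) ⊆ σ(x') at
once; the reverse inclusion is `mem_chamber_of_mem_intrinsicInterior`, which shows that every face
lying over x also lies over x'. -/

open Filter Topology

/-! ### Prolonging segments and relative interiors -/

section IntrinsicInterior

variable {E : Type*} [NormedAddCommGroup E] [NormedSpace ℝ E]

/-- A segment of `C` ending at a point of the intrinsic interior can be prolonged inside `C`. -/
theorem eventually_add_smul_sub_mem_of_mem_intrinsicInterior {C : Set E} {x z : E}
    (hx : x ∈ intrinsicInterior ℝ C) (hz : z ∈ C) :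
    ∀ᶠ t : ℝ in 𝓝 0, x + t • (x - z) ∈ C := by
  obtain ⟨u, hu, rfl⟩ := hx
  have hmem (t : ℝ) : (u : E) + t • ((u : E) - z) ∈ affineSpan ℝ C := by
    have := AffineSubspace.vadd_mem_of_mem_direction
      ((affineSpan ℝ C).direction.smul_mem t
        (AffineSubspace.vsub_mem_direction u.2 (subset_affineSpan ℝ C hz))) u.2
    simpa [add_comm] using this
  have hcont : Continuous fun t : ℝ => (⟨_, hmem t⟩ : affineSpan ℝ C) := by
    refine Continuous.subtype_mk ?_ _
    fun_prop
  have h0 : (⟨_, hmem 0⟩ : affineSpan ℝ C) = u := by ext; simp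
  have := hcont.continuousAt (x := 0)
  rw [ContinuousAt, h0] at this
  exact (this.eventually (isOpen_interior.mem_nhds hu)).mono fun t ht => by
    exact interior_subset (s := ((↑) ⁻¹' C : Set (affineSpan ℝ C))) ht

/-- In a convex set, moving from a point of the intrinsic interior towards another point of the
set, without reaching it, stays in the intrinsic interior. -/
theorem add_smul_sub_mem_intrinsicInterior {C : Set E} (hC : Convex ℝ C) {c w : E}
    (hc : c ∈ intrinsicInterior ℝ C) (hw : w ∈ C) {s : ℝ} (hs : 0 < s) (hs1 : s ≤ 1) :
    w + s • (c - w) ∈ intrinsicInterior ℝ C := by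
  obtain ⟨u, hu, rfl⟩ := hc
  have hwS := subset_affineSpan ℝ C hw
  have hmem (r : ℝ) (v : affineSpan ℝ C) : w + r • ((v : E) - w) ∈ affineSpan ℝ C := by
    have := AffineSubspace.vadd_mem_of_mem_direction
      ((affineSpan ℝ C).direction.smul_mem r (AffineSubspace.vsub_mem_direction v.2 hwS)) hwS
    simpa [add_comm] using this
  have hcont (r : ℝ) : Continuous fun v : affineSpan ℝ C =>
      (⟨_, hmem r v⟩ : affineSpan ℝ C) := by
    refine Continuous.subtype_mk ?_ _
    fun_prop
  refine ⟨⟨_, hmem s u⟩, ?_, rfl⟩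
  rw [mem_interior]
  refine ⟨(fun v => (⟨_, hmem s⁻¹ v⟩ : affineSpan ℝ C)) ⁻¹'
    interior ((↑) ⁻¹' C : Set (affineSpan ℝ C)), ?_, isOpen_interior.preimage (hcont _), ?_⟩
  · intro v hv
    have hv' : w + s⁻¹ • ((v : E) - w) ∈ C :=
      interior_subset (s := ((↑) ⁻¹' C : Set (affineSpan ℝ C))) hv
    have := hC.add_smul_sub_mem hw hv' ⟨hs.le, hs1⟩
    simpa [smul_smul, hs.ne'] using this
  · have : (⟨_, hmem s⁻¹ ⟨_, hmem s u⟩⟩ : affineSpan ℝ C) = u := by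
      ext; simp [smul_smul, hs.ne']
    simpa only [Set.mem_preimage, this] using hu

/-- A point `x` of a finite-dimensional convex set `C` lies in its intrinsic interior as soon as
every segment of `C` ending at `x` can be prolonged beyond `x` inside `C`. -/
theorem mem_intrinsicInterior_of_forall_exists [FiniteDimensional ℝ E] {C : Set E}
    (hC : Convex ℝ C) {x : E} (hx : x ∈ C)
    (h : ∀ z ∈ C, ∃ t : ℝ, 0 < t ∧ x + t • (x - z) ∈ C) : x ∈ intrinsicInterior ℝ C := by
  obtain ⟨c, hc⟩ := Set.Nonempty.intrinsicInterior hC ⟨x, hx⟩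
  obtain ⟨t, ht, hw⟩ := h c (intrinsicInterior_subset hc)
  have hpos : 0 < 1 + t := by positivity
  -- With w = x + t(x - c), this weight is the position of x on the segment from w to c.
  have := add_smul_sub_mem_intrinsicInterior hC hc hw (s := t / (1 + t)) (by positivity)
    ((div_le_one hpos).2 (by linarith))
  convert this using 1
  have hct : c - (x + t • (x - c)) = (1 + t) • (c - x) := by module
  rw [hct, smul_smul, div_mul_cancel₀ _ hpos.ne']
  module

end IntrinsicInterior

theorem IsFace.convex {E : Type*} [AddCommGroup E] [Module ℝ E] {P F : Set E}
    (hF : IsFace P F) (hP : Convex ℝ P) : Convex ℝ F := by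
  obtain ⟨l, rfl⟩ := hF
  intro p hp q hq s t hs ht hst
  refine ⟨hP hp.1 hq.1 hs ht hst, fun r hr => ?_⟩
  have h1 := mul_le_mul_of_nonneg_left (hp.2 r hr) hs
  have h2 := mul_le_mul_of_nonneg_left (hq.2 r hr) ht
  have h3 : l r = s * l r + t * l r := by rw [← add_mul, hst, one_mul]
  simp only [map_add, map_smul, smul_eq_mul]
  linarith

/-! ### Minimal faces of polyhedra -/

section Polyhedron

variable {E ι : Type*} [AddCommGroup E] [Module ℝ E]

/-- The set of points satisfying the inequalities `a i p ≤ b i`. -/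
def halfspaceInter (a : ι → E →ₗ[ℝ] ℝ) (b : ι → ℝ) : Set E :=
  {p | ∀ i, a i p ≤ b i}

/-- The points of `halfspaceInter a b` at which the inequalities indexed by `I` are tight. -/
def tightFace (a : ι → E →ₗ[ℝ] ℝ) (b : ι → ℝ) (I : Set ι) : Set E :=
  {p | p ∈ halfspaceInter a b ∧ ∀ i ∈ I, a i p = b i}

/-- The indices of the inequalities that are tight at `p`. -/
def tightIndices (a : ι → E →ₗ[ℝ] ℝ) (b : ι → ℝ) (p : E) : Set ι :=
  {i | a i p = b i}

variable {a : ι → E →ₗ[ℝ] ℝ} {b : ι → ℝ}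

theorem convex_halfspaceInter : Convex ℝ (halfspaceInter a b) := by
  have : halfspaceInter a b = ⋂ i, {p | a i p ≤ b i} := by ext; simp [halfspaceInter]
  rw [this]
  exact convex_iInter fun i => convex_halfSpace_le (a i).isLinear (b i)

theorem mem_tightFace_tightIndices {p : E} (hp : p ∈ halfspaceInter a b) :
    p ∈ tightFace a b (tightIndices a b p) :=
  ⟨hp, fun _ hi => hi⟩

/-- The sum of the functionals in `I` is bounded by the sum of their bounds. The point `p` attains
it, so maximizing means tightness in each term. -/
theorem isFace_tightFace [Finite ι] {p : E} {I : Set ι} (hp : p ∈ tightFace a b I) :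
    IsFace (halfspaceInter a b) (tightFace a b I) := by
  classical
  have := Fintype.ofFinite ι
  refine ⟨∑ i ∈ I.toFinset, a i, Set.ext fun q => ⟨fun hq => ⟨hq.1, fun r hr => ?_⟩,
    fun hq => ⟨hq.1, ?_⟩⟩⟩
  · simp only [LinearMap.sum_apply]
    refine Finset.sum_le_sum fun i hi => ?_
    rw [hq.2 i (Set.mem_toFinset.1 hi)]
    exact hr i
  · have h := hq.2 p hp.1
    simp only [LinearMap.sum_apply] at h
    have hp' : ∑ i ∈ I.toFinset, a i p = ∑ i ∈ I.toFinset, b i :=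
      Finset.sum_congr rfl fun i hi => hp.2 i (Set.mem_toFinset.1 hi)
    have hle : ∀ i ∈ I.toFinset, a i q ≤ b i := fun i _ => hq.1 i
    have heq := (Finset.sum_eq_sum_iff_of_le hle).1
      (le_antisymm (Finset.sum_le_sum hle) (hp' ▸ h))
    exact fun i hi => heq i (Set.mem_toFinset.2 hi)

/-- Small moves from `p` in a direction that does not increase the tight constraints stay in the
polyhedron. -/
theorem eventually_add_smul_mem_halfspaceInter [Finite ι] {p v : E}
    (hp : p ∈ halfspaceInter a b) (hv : ∀ i ∈ tightIndices a b p, a i v ≤ 0) :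
    ∀ᶠ t : ℝ in 𝓝[>] 0, p + t • v ∈ halfspaceInter a b := by
  refine eventually_all.2 fun i => ?_
  by_cases hi : a i p = b i
  · filter_upwards [self_mem_nhdsWithin] with t ht
    have := mul_nonpos_of_nonneg_of_nonpos (le_of_lt ht) (hv i hi)
    simp only [map_add, map_smul, smul_eq_mul]
    linarith
  · have hlt : a i p + 0 * a i v < b i := by simpa using lt_of_le_of_ne (hp i) hi
    have hc : Continuous fun t : ℝ => a i p + t * a i v := by fun_prop
    have := (hc.continuousAt (x := 0)).eventually (gt_mem_nhds hlt)
    filter_upwards [this.filter_mono nhdsWithin_le_nhds] with t ht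
    simpa using ht.le

/-- Small moves from `p` in a direction that keeps the tight constraints constant stay in the
minimal face of `p`. -/
theorem eventually_add_smul_mem_tightFace [Finite ι] {p v : E}
    (hp : p ∈ halfspaceInter a b) (hv : ∀ i ∈ tightIndices a b p, a i v = 0) :
    ∀ᶠ t : ℝ in 𝓝[>] 0, p + t • v ∈ tightFace a b (tightIndices a b p) := by
  filter_upwards [eventually_add_smul_mem_halfspaceInter hp fun i hi => (hv i hi).le] with t ht
  refine ⟨ht, fun i hi => ?_⟩
  have : a i p = b i := hi
  simp [hv i hi, this]

theorem map_sub_eq_zero_of_mem_tightFace {q r : E} {I : Set ι} (hq : q ∈ tightFace a b I)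
    (hr : r ∈ tightFace a b I) : ∀ i ∈ I, a i (q - r) = 0 := fun i hi => by
  rw [map_sub, hq.2 i hi, hr.2 i hi, sub_self]

/-- The tight constraints at `p` cut out the smallest face containing `p`. -/
theorem tightFace_subset_of_isFace [Finite ι] {p : E} {F : Set E}
    (hF : IsFace (halfspaceInter a b) F) (hp : p ∈ F) :
    tightFace a b (tightIndices a b p) ⊆ F := by
  obtain ⟨l, rfl⟩ := hF
  intro q hq
  -- Step slightly past `p`, away from `q`: were `l q < l p`, this would increase `l` beyond its
  -- maximum.
  have hev := eventually_add_smul_mem_halfspaceInter hp.1 (v := p - q) fun i hi =>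
    (map_sub_eq_zero_of_mem_tightFace (mem_tightFace_tightIndices hp.1) hq i hi).le
  obtain ⟨t, ht, ht0⟩ := (hev.and self_mem_nhdsWithin).exists
  have h := hp.2 _ ht
  simp only [map_add, map_smul, map_sub, smul_eq_mul] at h
  have hpq : l p ≤ l q := by
    by_contra hlt
    have := mul_pos ht0 (sub_pos.2 (not_le.1 hlt))
    linarith
  exact ⟨hq.1, fun r hr => (hp.2 r hr).trans hpq⟩

end Polyhedron

/-! ### Chambers -/

section Chambers

variable {ι : Type*} {nx ny : ℕ} {a : ι → (Fin nx → ℝ) × (Fin ny → ℝ) →ₗ[ℝ] ℝ} {b : ι → ℝ}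

theorem mem_chamber_iff {D : Set ((Fin nx → ℝ) × (Fin ny → ℝ))} {x z : Fin nx → ℝ} :
    z ∈ chamber D x ↔ ∀ F, IsFace D F → x ∈ proj F → z ∈ proj F :=
  ⟨fun h F hF hx => h _ ⟨F, hF, hx, rfl⟩, by rintro h _ ⟨F, hF, hx, rfl⟩; exact h F hF hx⟩

theorem self_mem_chamber {D : Set ((Fin nx → ℝ) × (Fin ny → ℝ))} {x : Fin nx → ℝ} :
    x ∈ chamber D x :=
  mem_chamber_iff.2 fun _ _ hx => hx

theorem chamber_subset_of_mem {D : Set ((Fin nx → ℝ) × (Fin ny → ℝ))} {x z : Fin nx → ℝ}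
    (hz : z ∈ chamber D x) : chamber D z ⊆ chamber D x := fun _ hw =>
  mem_chamber_iff.2 fun F hF hx => mem_chamber_iff.1 hw F hF (mem_chamber_iff.1 hz F hF hx)

theorem convex_chamber {D : Set ((Fin nx → ℝ) × (Fin ny → ℝ))} (hD : Convex ℝ D)
    (x : Fin nx → ℝ) : Convex ℝ (chamber D x) := by
  refine convex_sInter ?_
  rintro _ ⟨F, hF, -, rfl⟩
  exact (IsFace.convex hF hD).linear_image (LinearMap.fst ℝ _ _)

/-- Chambers are cut out by the minimal faces of the points in the fiber. -/
theorem mem_chamber_of_forall_tightFace [Finite ι] {x z : Fin nx → ℝ}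
    (h : ∀ p ∈ halfspaceInter a b, p.1 = x → z ∈ proj (tightFace a b (tightIndices a b p))) :
    z ∈ chamber (halfspaceInter a b) x := by
  refine mem_chamber_iff.2 ?_
  rintro F hF ⟨p, hp, rfl⟩
  have hpD : p ∈ halfspaceInter a b := by
    obtain ⟨l, rfl⟩ := hF
    exact hp.1
  exact Set.image_mono (tightFace_subset_of_isFace hF hp) (h p hpD rfl)

theorem exists_mem_tightFace_of_mem_chamber [Finite ι] {z : Fin nx → ℝ}
    {p : (Fin nx → ℝ) × (Fin ny → ℝ)} (hp : p ∈ halfspaceInter a b)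
    (hz : z ∈ chamber (halfspaceInter a b) p.1) :
    ∃ q ∈ tightFace a b (tightIndices a b p), q.1 = z :=
  have hpt := mem_tightFace_tightIndices hp
  mem_chamber_iff.1 hz _ (isFace_tightFace hpt) ⟨p, hpt, rfl⟩

theorem self_mem_intrinsicInterior_chamber [Finite ι] (x : Fin nx → ℝ) :
    x ∈ intrinsicInterior ℝ (chamber (halfspaceInter a b) x) := by
  refine mem_intrinsicInterior_of_forall_exists (convex_chamber convex_halfspaceInter x)
    self_mem_chamber fun z hz => ?_
  -- Quantifying over the finitely many index sets, not over points of the fiber, yields one common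
  -- `t`.
  have hev : ∀ᶠ t : ℝ in 𝓝[>] 0, ∀ I : Set ι,
      (∃ p ∈ halfspaceInter a b, p.1 = x ∧ tightIndices a b p = I) →
        x + t • (x - z) ∈ proj (tightFace a b I) := by
    refine eventually_all.2 fun I => ?_
    by_cases hI : ∃ p ∈ halfspaceInter a b, p.1 = x ∧ tightIndices a b p = I
    · obtain ⟨p, hp, rfl, rfl⟩ := hI
      obtain ⟨q, hq, rfl⟩ := exists_mem_tightFace_of_mem_chamber hp hz
      filter_upwards [eventually_add_smul_mem_tightFace hp
        (map_sub_eq_zero_of_mem_tightFace (mem_tightFace_tightIndices hp) hq)] with t ht _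
      exact ⟨_, ht, rfl⟩
    · exact Eventually.of_forall fun t h => absurd h hI
  obtain ⟨t, ht, ht0⟩ := (hev.and self_mem_nhdsWithin).exists
  exact ⟨t, ht0, mem_chamber_of_forall_tightFace fun p hp hpx => ht _ ⟨p, hp, hpx, rfl⟩⟩

/-- If `p` maximizes `l` in its fiber and `q` lies in the minimal face of `p`, then every point of
the segment from `p` to `q` maximizes `l` in its fiber. -/
theorem le_of_forall_fiber_le [Finite ι] {l : (Fin nx → ℝ) × (Fin ny → ℝ) →ₗ[ℝ] ℝ}
    {p q r : (Fin nx → ℝ) × (Fin ny → ℝ)} (hp : p ∈ halfspaceInter a b)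
    (hmax : ∀ p' ∈ halfspaceInter a b, p'.1 = p.1 → l p' ≤ l p)
    (hq : q ∈ tightFace a b (tightIndices a b p)) (hr : r ∈ halfspaceInter a b) {s : ℝ}
    (hfib : r.1 = (p + s • (q - p)).1) : l r ≤ l (p + s • (q - p)) := by
  -- This direction is vertical, and the constraints tight at `p` do not increase along it since
  -- they vanish on `q - p`; the move stays in the fiber of `p`.
  have hev := eventually_add_smul_mem_halfspaceInter hp (v := r - (p + s • (q - p)))
    fun i hi => by
      have h0 := map_sub_eq_zero_of_mem_tightFace hq (mem_tightFace_tightIndices hp) i hi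
      have hpi : a i p = b i := hi
      have := hr i
      rw [map_sub, map_add, map_smul, h0, smul_zero]
      linarith
  obtain ⟨t, ht, ht0⟩ := (hev.and self_mem_nhdsWithin).exists
  have h := hmax _ ht (by simp [hfib])
  rw [map_add, map_smul, map_sub, smul_eq_mul] at h
  by_contra hlt
  have := mul_pos ht0 (sub_pos.2 (not_le.1 hlt))
  linarith

/-- Let `l` define a face over x, and let `p` maximize `l` over the fiber of x'. Prolong the segment
from x' to x and lift its end to `q` in the minimal face of `p`. The point of the segment pq over x
is then a global maximizer of `l`, and since it is interior to the segment, `p` is one too. -/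
theorem mem_chamber_of_mem_intrinsicInterior [Finite ι]
    (hcompact : IsCompact (halfspaceInter a b)) {x x' : Fin nx → ℝ}
    (hx' : x' ∈ proj (halfspaceInter a b))
    (hx : x ∈ intrinsicInterior ℝ (chamber (halfspaceInter a b) x')) :
    x' ∈ chamber (halfspaceInter a b) x := by
  refine mem_chamber_iff.2 ?_
  rintro _ ⟨l, rfl⟩ ⟨f, ⟨hfD, hfmax⟩, rfl⟩
  obtain ⟨p, ⟨hp, hpx⟩, hmax⟩ := (hcompact.inter_right
      (isClosed_singleton.preimage continuous_fst : IsClosed (Prod.fst ⁻¹' {x'}))).exists_isMaxOn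
    (by obtain ⟨p, hp, h⟩ := hx'; exact ⟨p, hp, h⟩)
    l.continuous_of_finiteDimensional.continuousOn
  obtain rfl : p.1 = x' := hpx
  have hprolong := eventually_add_smul_sub_mem_of_mem_intrinsicInterior hx self_mem_chamber
  obtain ⟨t, ht, ht0 : 0 < t⟩ :=
    ((hprolong.filter_mono nhdsWithin_le_nhds).and
      (self_mem_nhdsWithin : Set.Ioi (0 : ℝ) ∈ 𝓝[>] 0)).exists
  obtain ⟨q, hq, hqw⟩ := exists_mem_tightFace_of_mem_chamber hp ht
  have hpos : 0 < 1 + t := by positivity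
  -- The parameter 1/(1+t) selects the point of the segment pq lying over x.
  have hle := le_of_forall_fiber_le (l := l) hp (fun p' hp' h => hmax ⟨hp', h⟩) hq hfD
    (s := (1 + t)⁻¹) (by
      simp only [Prod.fst_add, Prod.smul_fst, Prod.fst_sub, hqw]
      have : f.1 + t • (f.1 - p.1) - p.1 = (1 + t) • (f.1 - p.1) := by module
      rw [this, inv_smul_smul₀ hpos.ne']
      abel)
  have hqf := hfmax q hq.1
  refine ⟨p, ⟨hp, fun r hr => (hfmax r hr).trans ?_⟩, rfl⟩
  simp only [map_add, map_smul, map_sub, smul_eq_mul] at hle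
  have h1 := mul_le_mul_of_nonneg_left hle hpos.le
  rw [mul_add, mul_inv_cancel_left₀ hpos.ne'] at h1
  by_contra hlt
  have := mul_pos ht0 (sub_pos.2 (not_le.1 hlt))
  linarith

theorem mem_intrinsicInterior_chamber_iff [Finite ι]
    (hcompact : IsCompact (halfspaceInter a b)) {x x' : Fin nx → ℝ}
    (hx' : x' ∈ proj (halfspaceInter a b)) :
    x ∈ intrinsicInterior ℝ (chamber (halfspaceInter a b) x') ↔
      chamber (halfspaceInter a b) x' = chamber (halfspaceInter a b) x :=
  ⟨fun hx => (chamber_subset_of_mem (mem_chamber_of_mem_intrinsicInterior hcompact hx' hx)).antisymm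
    (chamber_subset_of_mem (intrinsicInterior_subset hx)),
    fun h => h ▸ self_mem_intrinsicInterior_chamber x⟩

/-- If no nonzero vertical direction keeps the constraints tight at `p` constant, the minimal face
of `p` has dimension at most `nx`. -/
theorem adim_tightFace_le {p : (Fin nx → ℝ) × (Fin ny → ℝ)}
    (hinj : ∀ v : (Fin nx → ℝ) × (Fin ny → ℝ), v.1 = 0 →
      (∀ i ∈ tightIndices a b p, a i v = 0) → v = 0) :
    adim (tightFace a b (tightIndices a b p)) ≤ nx := by
  have hdir : ∀ v ∈ (affineSpan ℝ (tightFace a b (tightIndices a b p))).direction,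
      ∀ i ∈ tightIndices a b p, a i v = 0 := by
    intro v hv i hi
    rw [direction_affineSpan, vectorSpan_def] at hv
    refine (Submodule.span_le (p := LinearMap.ker (a i))).2 ?_ hv
    rintro _ ⟨q, hq, r, hr, rfl⟩
    exact map_sub_eq_zero_of_mem_tightFace hq hr i hi
  have h := LinearMap.finrank_le_finrank_of_injective
    (f := (LinearMap.fst ℝ (Fin nx → ℝ) (Fin ny → ℝ)).comp
      (affineSpan ℝ (tightFace a b (tightIndices a b p))).direction.subtype)
    ((injective_iff_map_eq_zero _).2 fun v hv => Subtype.ext (hinj v hv (hdir v v.2)))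
  simpa [adim] using h

theorem exists_facesLE_subset [Finite ι] (hcompact : IsCompact (halfspaceInter a b))
    {x : Fin nx → ℝ} {F : Set ((Fin nx → ℝ) × (Fin ny → ℝ))}
    (hF : IsFace (halfspaceInter a b) F) (hx : x ∈ proj F) :
    ∃ G ∈ facesLE (halfspaceInter a b) nx, x ∈ proj G ∧ G ⊆ F := by
  have hFD : F ⊆ halfspaceInter a b := by
    obtain ⟨l, rfl⟩ := hF
    exact fun _ h => h.1
  have hFc : IsCompact F := by
    refine hcompact.of_isClosed_subset ?_ hFD
    obtain ⟨l, rfl⟩ := hF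
    have hl := l.continuous_of_finiteDimensional
    have : {p | p ∈ halfspaceInter a b ∧ ∀ q ∈ halfspaceInter a b, l q ≤ l p} =
        halfspaceInter a b ∩ ⋂ q ∈ halfspaceInter a b, {p | l q ≤ l p} := by ext; simp
    rw [this]
    exact hcompact.isClosed.inter
      (isClosed_biInter fun q _ => isClosed_le continuous_const hl)
  obtain ⟨p, hpe⟩ := (hFc.inter_right
      (isClosed_singleton.preimage continuous_fst : IsClosed
        (Prod.fst ⁻¹' {x} : Set ((Fin nx → ℝ) × (Fin ny → ℝ))))).extremePoints_nonempty
    (by obtain ⟨p, hp, h⟩ := hx; exact ⟨p, hp, h⟩)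
  obtain ⟨⟨hpF, hpx⟩, hext⟩ := mem_extremePoints_iff_left.1 hpe
  have hpD := hFD hpF
  have hpt := mem_tightFace_tightIndices hpD
  have hsub := tightFace_subset_of_isFace hF hpF
  refine ⟨_, ⟨isFace_tightFace hpt, adim_tightFace_le fun v hv0 hv => ?_⟩, ⟨p, hpt, hpx⟩, hsub⟩
  -- A vertical `v` makes `p` the midpoint of p ± tv within the fiber of `F`, so extremality forces
  -- `v = 0`.
  obtain ⟨t, ⟨ht, ht'⟩, ht0 : 0 < t⟩ := (((eventually_add_smul_mem_tightFace hpD hv).and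
    (eventually_add_smul_mem_tightFace hpD (v := -v) fun i hi => by
      rw [map_neg, hv i hi, neg_zero])).and
        (self_mem_nhdsWithin : Set.Ioi (0 : ℝ) ∈ 𝓝[>] 0)).exists
  have hpx' : p.1 = x := hpx
  have h := hext _ ⟨hsub ht, by simp [hv0, hpx']⟩ _ ⟨hsub ht', by simp [hv0, hpx']⟩
    ⟨1 / 2, 1 / 2, by norm_num, by norm_num, by norm_num, by module⟩
  simpa [ht0.ne'] using h

theorem chamber_eq_sInter_facesLE [Finite ι] (hcompact : IsCompact (halfspaceInter a b))
    (x : Fin nx → ℝ) :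
    chamber (halfspaceInter a b) x =
      ⋂₀ {Q | ∃ F ∈ facesLE (halfspaceInter a b) nx, x ∈ proj F ∧ Q = proj F} := by
  refine Set.Subset.antisymm ?_ fun z hz => mem_chamber_iff.2 fun F hF hx => ?_
  · rintro z hz _ ⟨F, hF, hx, rfl⟩
    exact mem_chamber_iff.1 hz F hF.1 hx
  · obtain ⟨G, hG, hxG, hGF⟩ := exists_facesLE_subset hcompact hF hx
    exact Set.image_mono hGF (hz _ ⟨G, hG, hxG, rfl⟩)

theorem polyhedron_eq_halfspaceInter {m : ℕ} (A : Matrix (Fin m) (Fin nx) ℝ)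
    (B : Matrix (Fin m) (Fin ny) ℝ) (b : Fin m → ℝ) :
    polyhedron A B b =
      halfspaceInter (fun i => LinearMap.proj i ∘ₗ A.mulVecLin.coprod B.mulVecLin) b := by
  ext p
  simp [polyhedron, halfspaceInter, Pi.le_def]

end Chambers

end Chamber

theorem mainTheorem9 {m nx ny : ℕ} (A : Matrix (Fin m) (Fin nx) ℝ)
    (B : Matrix (Fin m) (Fin ny) ℝ) (b : Fin m → ℝ)
    (hcompact : IsCompact (Chamber.polyhedron A B b))
    (hfull : Chamber.adim (Chamber.polyhedron A B b) = nx + ny)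
    (x : Fin nx → ℝ) (hx : x ∈ Chamber.proj (Chamber.polyhedron A B b)) :
    Chamber.chamber (Chamber.polyhedron A B b) x =
        ⋂₀ {Q | ∃ F ∈ Chamber.facesLE (Chamber.polyhedron A B b) nx,
          x ∈ Chamber.proj F ∧ Q = Chamber.proj F} ∧
      ∀ C ∈ Chamber.chamberComplex (Chamber.polyhedron A B b),
        x ∈ intrinsicInterior ℝ C ↔ C = Chamber.chamber (Chamber.polyhedron A B b) x := by
  rw [Chamber.polyhedron_eq_halfspaceInter] at hcompact ⊢
  refine ⟨Chamber.chamber_eq_sInter_facesLE hcompact x, ?_⟩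
  rintro _ ⟨x', hx', rfl⟩
  exact Chamber.mem_intrinsicInterior_chamber_iff hcompact hx'
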